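/- Let $\mathbb D$ be the open unit disk in $\mathbb C$. A weight on $\mathbb D$ is a bounded, continuous, strictly positive function $\mu:\mathbb D\to(0,\infty)$. For a holomorphic function $f$ on $\mathbb D$ put $\|f\|_\mu=\sup_{z\in\mathbb D}\mu(z)|f'(z)|$. The $\mu$-Bloch space $\mathcal B^\mu$ is the space of all holomorphic $f$ on $\mathbb D$ with $\|f\|_\mu<\infty$, normed by $\|f\|_{\mathcal B^\mu}=|f(0)|+\|f\|_\mu$. The log-Bloch space $\mathcal B^{\log}$ is $\mathcal B^{v_{\log}}$ for the weight $v_{\log}(z)=(1-|z|)\log\frac{3}{1-|z|}$, and $\|\cdot\|_{\log}=\|\cdot\|_{v_{\log}}$. Let $F_j(z)=z^j$. Let $\mu$ be a weight on $\mathbb D$ and let $\varphi:\mathbb D\to\mathbb D$ be holomorphic; $\varphi^j$ denotes the $j$-th pointwise power of $\varphi$. Say that $C_\varphi:\mathcal B^{\log}\to\mathcal B^\mu$ is compact if $f\circ\varphi\in\mathcal B^\mu$ for all $f\in\mathcal B^{\log}$ and the linear operator $C_\varphi f=f\circ\varphi$ from $\mathcal B^{\log}$ to $\mathcal B^\mu$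 is compact. Then the following are equivalent: (i) $C_\varphi:\mathcal B^{\log}\to\mathcal B^\mu$ is compact; (ii) $\|\varphi^j\|_\mu<\infty$ for all $j\ge 1$, and $\displaystyle\lim_{j\to\infty}\frac{\|\varphi^j\|_\mu}{\log(j+1)}=0$; (iii) $\|\varphi^j\|_\mu<\infty$ for all $j\ge 1$, and $\displaystyle\lim_{j\to\infty}\frac{\|\varphi^j\|_\mu}{\|F_j\|_{\log}}=0$. -/

import Mathlib

open Filter
open scoped Topology Complex.UnitDisc

noncomputable section

namespace LogBloch

/-- Extension by zero of a function on the open unit disc to the whole plane. It is only used to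
speak of complex differentiability and of the derivative at points of the (open) disc. -/
def extend (f : 𝔻 → ℂ) (z : ℂ) : ℂ :=
  if hz : ‖z‖ < 1 then f (Complex.UnitDisc.mk z hz) else 0

/-- `f` is holomorphic on the open unit disc. -/
def IsHolomorphic (f : 𝔻 → ℂ) : Prop :=
  DifferentiableOn ℂ (extend f) (Metric.ball 0 1)

/-- The complex derivative `f'(z)` at a point `z` of the disc. -/
def derivative (f : 𝔻 → ℂ) (z : 𝔻) : ℂ :=
  deriv (extend f) (z : ℂ)

/-- A weight on the disc: a bounded, continuous and strictly positive function. -/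
structure Weight where
  /-- the underlying function -/
  toFun : 𝔻 → ℝ
  continuous : Continuous toFun
  pos : ∀ z, 0 < toFun z
  bounded : ∃ C, ∀ z, toFun z ≤ C

instance : CoeFun Weight (fun _ => 𝔻 → ℝ) := ⟨Weight.toFun⟩

/-- The semi-norm `‖f‖_μ = sup_{z ∈ 𝔻} μ(z) |f'(z)|`, meaningful if the supremum is finite. -/
def seminorm (μ : Weight) (f : 𝔻 → ℂ) : ℝ :=
  ⨆ z : 𝔻, μ z * ‖derivative f z‖

/-- `f` belongs to the `μ`-Bloch space: it is holomorphic on the disc and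
`sup_{z ∈ 𝔻} μ(z) |f'(z)| < ∞`. -/
def MemBloch (μ : Weight) (f : 𝔻 → ℂ) : Prop :=
  IsHolomorphic f ∧ BddAbove (Set.range fun z : 𝔻 => μ z * ‖derivative f z‖)

theorem extend_add (f g : 𝔻 → ℂ) : extend (f + g) = extend f + extend g := by
  funext z
  by_cases hz : ‖z‖ < 1 <;> simp [extend, hz]

theorem extend_smul (c : ℂ) (f : 𝔻 → ℂ) : extend (c • f) = c • extend f := by
  funext z
  by_cases hz : ‖z‖ < 1 <;> simp [extend, hz]

theorem extend_coe (f : 𝔻 → ℂ) (z : 𝔻) : extend f (z : ℂ) = f z := by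
  simp [extend, z.norm_lt_one]

theorem IsHolomorphic.differentiableAt {f : 𝔻 → ℂ} (hf : IsHolomorphic f) (z : 𝔻) :
    DifferentiableAt ℂ (extend f) (z : ℂ) :=
  DifferentiableOn.differentiableAt hf
    (Metric.isOpen_ball.mem_nhds (mem_ball_zero_iff.2 z.norm_lt_one))

theorem derivative_add {f g : 𝔻 → ℂ} (hf : IsHolomorphic f) (hg : IsHolomorphic g) (z : 𝔻) :
    derivative (f + g) z = derivative f z + derivative g z := by
  rw [derivative, extend_add]
  exact deriv_add (hf.differentiableAt z) (hg.differentiableAt z)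

theorem derivative_smul {f : 𝔻 → ℂ} (hf : IsHolomorphic f) (c : ℂ) (z : 𝔻) :
    derivative (c • f) z = c * derivative f z := by
  rw [derivative, extend_smul]
  exact deriv_const_smul c (hf.differentiableAt z)

theorem MemBloch.le_seminorm {μ : Weight} {f : 𝔻 → ℂ} (hf : MemBloch μ f) (z : 𝔻) :
    μ z * ‖derivative f z‖ ≤ seminorm μ f :=
  le_ciSup hf.2 z

theorem seminorm_nonneg (μ : Weight) (f : 𝔻 → ℂ) : 0 ≤ seminorm μ f :=
  Real.iSup_nonneg fun z => mul_nonneg (μ.pos z).le (norm_nonneg _)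

theorem MemBloch.add_le {μ : Weight} {f g : 𝔻 → ℂ} (hf : MemBloch μ f) (hg : MemBloch μ g)
    (z : 𝔻) : μ z * ‖derivative (f + g) z‖ ≤ seminorm μ f + seminorm μ g := by
  rw [derivative_add hf.1 hg.1]
  have h := mul_le_mul_of_nonneg_left (norm_add_le (derivative f z) (derivative g z)) (μ.pos z).le
  have h1 := hf.le_seminorm z
  have h2 := hg.le_seminorm z
  linarith

theorem MemBloch.add {μ : Weight} {f g : 𝔻 → ℂ} (hf : MemBloch μ f) (hg : MemBloch μ g) :
    MemBloch μ (f + g) := by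
  refine ⟨?_, seminorm μ f + seminorm μ g, ?_⟩
  · rw [IsHolomorphic, extend_add]
    exact DifferentiableOn.add hf.1 hg.1
  · rintro _ ⟨z, rfl⟩
    exact hf.add_le hg z

theorem MemBloch.smul {μ : Weight} {f : 𝔻 → ℂ} (c : ℂ) (hf : MemBloch μ f) :
    MemBloch μ (c • f) := by
  refine ⟨?_, ‖c‖ * seminorm μ f, ?_⟩
  · rw [IsHolomorphic, extend_smul]
    exact DifferentiableOn.const_smul hf.1 c
  · rintro _ ⟨z, rfl⟩
    have h := mul_le_mul_of_nonneg_left (hf.le_seminorm z) (norm_nonneg c)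
    simp only [derivative_smul hf.1, norm_mul]
    linarith

theorem MemBloch.zero (μ : Weight) : MemBloch μ (0 : 𝔻 → ℂ) := by
  have h : extend (0 : 𝔻 → ℂ) = fun _ => 0 := by
    funext z
    by_cases hz : ‖z‖ < 1 <;> simp [extend, hz]
  refine ⟨?_, 0, ?_⟩
  · rw [IsHolomorphic, h]
    exact differentiableOn_const 0
  · rintro _ ⟨z, rfl⟩
    simp [derivative, h]

/-- The `μ`-Bloch space as a linear subspace of the space of all functions on the disc. -/
def blochSubmodule (μ : Weight) : Submodule ℂ (𝔻 → ℂ) where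
  carrier := {f | MemBloch μ f}
  add_mem' := fun hf hg => MemBloch.add hf hg
  zero_mem' := MemBloch.zero μ
  smul_mem' := fun c _ hf => MemBloch.smul c hf

/-- The `μ`-Bloch space, as a type of its own: its topology is the one given by the norm
below, not that of pointwise convergence. -/
def Bloch (μ : Weight) : Type := blochSubmodule μ

instance (μ : Weight) : AddCommGroup (Bloch μ) := inferInstanceAs (AddCommGroup (blochSubmodule μ))

instance (μ : Weight) : Module ℂ (Bloch μ) := inferInstanceAs (Module ℂ (blochSubmodule μ))

/-- The norm `‖f‖_{𝓑^μ} = |f(0)| + ‖f‖_μ`. -/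
instance (μ : Weight) : Norm (Bloch μ) := ⟨fun f => ‖f.1 0‖ + seminorm μ f.1⟩

theorem norm_def {μ : Weight} (f : Bloch μ) : ‖f‖ = ‖f.1 0‖ + seminorm μ f.1 := rfl

theorem seminorm_smul {μ : Weight} {f : 𝔻 → ℂ} (c : ℂ) (hf : MemBloch μ f) :
    seminorm μ (c • f) = ‖c‖ * seminorm μ f := by
  rw [seminorm, seminorm, Real.mul_iSup_of_nonneg (norm_nonneg c)]
  refine iSup_congr fun z => ?_
  rw [derivative_smul hf.1, norm_mul]
  ring

theorem eq_zero_of_seminorm_eq_zero {μ : Weight} {f : 𝔻 → ℂ} (hf : MemBloch μ f)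
    (h0 : f 0 = 0) (h : seminorm μ f = 0) : f = 0 := by
  have hd : (Metric.ball (0 : ℂ) 1).EqOn (deriv (extend f)) 0 := by
    intro w hw
    have h1 := hf.le_seminorm (Complex.UnitDisc.mk w (mem_ball_zero_iff.1 hw))
    rw [h] at h1
    have h2 := nonpos_of_mul_nonpos_right h1 (μ.pos _)
    exact norm_le_zero_iff.1 h2
  funext z
  have hz := Metric.isOpen_ball.is_const_of_deriv_eq_zero
    (convex_ball (0 : ℂ) 1).isPreconnected hf.1 hd
    (mem_ball_zero_iff.2 z.norm_lt_one) (mem_ball_zero_iff.2 (0 : 𝔻).norm_lt_one)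
  rw [extend_coe, extend_coe, h0] at hz
  exact hz

theorem bloch_core (μ : Weight) : NormedSpace.Core ℂ (Bloch μ) where
  norm_nonneg f := add_nonneg (norm_nonneg _) (seminorm_nonneg μ _)
  norm_smul c f := by
    have h : (c • f).1 = c • f.1 := rfl
    rw [norm_def, norm_def, h, seminorm_smul c f.2, Pi.smul_apply, norm_smul]
    ring
  norm_triangle f g := by
    have h : (f + g).1 = f.1 + g.1 := rfl
    have h1 : seminorm μ (f.1 + g.1) ≤ seminorm μ f.1 + seminorm μ g.1 :=
      ciSup_le fun z => MemBloch.add_le f.2 g.2 z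
    have h2 := norm_add_le (f.1 0) (g.1 0)
    rw [norm_def, norm_def, norm_def, h, Pi.add_apply]
    linarith
  norm_eq_zero_iff f := by
    constructor
    · intro h
      rw [norm_def] at h
      have h1 := norm_nonneg (f.1 0)
      have h2 := seminorm_nonneg μ f.1
      exact Subtype.ext (eq_zero_of_seminorm_eq_zero f.2
        (norm_eq_zero.1 (by linarith)) (by linarith))
    · rintro rfl
      have h := seminorm_smul (0 : ℂ) (MemBloch.zero μ)
      have h0 : (0 : Bloch μ).1 = (0 : 𝔻 → ℂ) := rfl
      rw [norm_def, h0]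
      simpa using h

instance (μ : Weight) : NormedAddCommGroup (Bloch μ) := NormedAddCommGroup.ofCore (bloch_core μ)

instance (μ : Weight) : NormedSpace ℂ (Bloch μ) := NormedSpace.ofCore (bloch_core μ)

/-- The composition operator `C_φ f = f ∘ φ` from `𝓑^ν` to `𝓑^μ`, for a self-map `φ` of the
disc such that `f ∘ φ ∈ 𝓑^μ` for all `f ∈ 𝓑^ν`. -/
def compOp (ν μ : Weight) (φ : 𝔻 → 𝔻) (h : ∀ f, MemBloch ν f → MemBloch μ (f ∘ φ)) :
    Bloch ν →ₗ[ℂ] Bloch μ where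
  toFun f := ⟨f.1 ∘ φ, h f.1 f.2⟩
  map_add' _ _ := rfl
  map_smul' _ _ := rfl

/-- `C_φ : 𝓑^ν → 𝓑^μ` is a compact operator: composition with `φ` maps `𝓑^ν` into `𝓑^μ`, and
the resulting linear operator is compact. -/
def IsCompactCompOp (ν μ : Weight) (φ : 𝔻 → 𝔻) : Prop :=
  ∃ h : ∀ f, MemBloch ν f → MemBloch μ (f ∘ φ), IsCompactOperator (compOp ν μ φ h)

/-- The weight `v_log(z) = (1 - |z|) log (3 / (1 - |z|))`. -/
def vlog : Weight where
  toFun z := (1 - ‖(z : ℂ)‖) * Real.log (3 / (1 - ‖(z : ℂ)‖))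
  continuous := by
    have h : Continuous fun z : 𝔻 => 1 - ‖(z : ℂ)‖ :=
      continuous_const.sub Complex.UnitDisc.continuous_coe.norm
    have hne : ∀ z : 𝔻, 1 - ‖(z : ℂ)‖ ≠ 0 := fun z => (sub_pos.2 z.norm_lt_one).ne'
    exact h.mul ((continuous_const.div h hne).log fun z => div_ne_zero three_ne_zero (hne z))
  pos z := by
    have h := sub_pos.2 z.norm_lt_one
    have h0 := norm_nonneg (z : ℂ)
    refine mul_pos h (Real.log_pos ?_)
    rw [lt_div_iff₀ h]
    linarith
  bounded := by
    refine ⟨3, fun z => ?_⟩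
    have h := sub_pos.2 z.norm_lt_one
    have h1 := Real.log_le_self (div_pos three_pos h).le
    calc (1 - ‖(z : ℂ)‖) * Real.log (3 / (1 - ‖(z : ℂ)‖))
        ≤ (1 - ‖(z : ℂ)‖) * (3 / (1 - ‖(z : ℂ)‖)) := mul_le_mul_of_nonneg_left h1 h.le
      _ = 3 := mul_div_cancel₀ 3 h.ne'

/-- The monomial `F_j(z) = z^j` on the disc. -/
def monomial (j : ℕ) (z : 𝔻) : ℂ := (z : ℂ) ^ j

/-- The power `φ^j` (pointwise, not iterated) of a self-map `φ` of the disc. -/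
def power (φ : 𝔻 → 𝔻) (j : ℕ) (z : 𝔻) : ℂ := (φ z : ℂ) ^ j

end LogBloch

end

/-!
Conditions (i) and (ii) are both equivalent to the pointwise condition
`μ(z) |φ'(z)| = o(v_log(φ(z)))` as `|φ(z)| → 1`. By the chain rule `μ |(f ∘ φ)'|` is
`(μ |φ'| / v_log ∘ φ) * (v_log |f'|) ∘ φ`, so under this condition `C_φ` maps bounded sequences
whose derivatives converge locally uniformly to convergent ones, and it is compact by Montel's
theorem. Conversely, a compact `C_φ` sends the bounded, pointwise null sequence `F_j / ‖F_j‖_log` to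
a null sequence. Finally `v_log |F_j'|` is at most `4 log (j + 1)`, and of this order at
`|w| = 1 - 1 / (2 j)`; choosing `j` according to `w = φ(z)`, the smallness of
`‖φ^j‖_μ / log (j + 1)` gives back the pointwise condition.
-/

namespace LogBloch

open Metric Asymptotics
open scoped NNReal

section Disc

theorem extend_eqOn {f : 𝔻 → ℂ} {F : ℂ → ℂ} (h : ∀ z : 𝔻, f z = F z) :
    (ball 0 1).EqOn (extend f) F := by
  intro w hw
  lift w to 𝔻 using mem_ball_zero_iff.1 hw
  rw [extend_coe, h]

theorem isHolomorphic_of_differentiableOn {f : 𝔻 → ℂ} {F : ℂ → ℂ}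
    (hF : DifferentiableOn ℂ F (ball 0 1)) (h : ∀ z : 𝔻, f z = F z) : IsHolomorphic f :=
  hF.congr (extend_eqOn h)

theorem coe_mem_ball (z : 𝔻) : (z : ℂ) ∈ ball (0 : ℂ) 1 :=
  mem_ball_zero_iff.2 z.norm_lt_one

theorem derivative_eq_deriv {f : 𝔻 → ℂ} {F : ℂ → ℂ} (h : ∀ z : 𝔻, f z = F z) (z : 𝔻) :
    derivative f z = deriv F z :=
  ((extend_eqOn h).eventuallyEq_of_mem (isOpen_ball.mem_nhds (coe_mem_ball z))).deriv_eq

theorem derivative_sub {f g : 𝔻 → ℂ} (hf : IsHolomorphic f) (hg : IsHolomorphic g) (z : 𝔻) :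
    derivative (f - g) z = derivative f z - derivative g z :=
  (derivative_eq_deriv (F := extend f - extend g) (fun z => by simp [extend_coe]) z).trans
    (deriv_sub (hf.differentiableAt z) (hg.differentiableAt z))

variable {f : 𝔻 → ℂ} {φ : 𝔻 → 𝔻}

theorem comp_apply_eq_extend_comp_extend (f : 𝔻 → ℂ) (φ : 𝔻 → 𝔻) (z : 𝔻) :
    (f ∘ φ) z = (extend f ∘ extend (fun z => (φ z : ℂ))) z := by
  simp only [Function.comp_apply, extend_coe]

theorem mapsTo_extend_ball (φ : 𝔻 → 𝔻) :
    Set.MapsTo (extend (fun z => (φ z : ℂ))) (ball 0 1) (ball 0 1) := by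
  intro w hw
  lift w to 𝔻 using mem_ball_zero_iff.1 hw
  simpa only [extend_coe] using coe_mem_ball (φ w)

theorem IsHolomorphic.comp (hf : IsHolomorphic f) (hφ : IsHolomorphic fun z => (φ z : ℂ)) :
    IsHolomorphic (f ∘ φ) :=
  isHolomorphic_of_differentiableOn (DifferentiableOn.comp hf hφ (mapsTo_extend_ball φ))
    (comp_apply_eq_extend_comp_extend f φ)

theorem derivative_comp (hf : IsHolomorphic f) (hφ : IsHolomorphic fun z => (φ z : ℂ)) (z : 𝔻) :
    derivative (f ∘ φ) z = derivative f (φ z) * derivative (fun z => (φ z : ℂ)) z := by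
  have hφz : extend (fun z => (φ z : ℂ)) z = φ z := extend_coe _ z
  rw [derivative_eq_deriv (comp_apply_eq_extend_comp_extend f φ),
    deriv_comp _ (by rw [hφz]; exact hf.differentiableAt (φ z)) (hφ.differentiableAt z), hφz]
  rfl

theorem tendstoLocallyUniformly_derivative {ι : Type*} {l : Filter ι} {F : ι → 𝔻 → ℂ}
    (hF : ∀ i, IsHolomorphic (F i))
    (h : TendstoLocallyUniformlyOn (fun i => extend (F i)) (extend f) l (ball 0 1)) :
    TendstoLocallyUniformly (fun i => derivative (F i)) (derivative f) l := by
  rw [← tendstoLocallyUniformlyOn_univ]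
  exact (h.deriv (.of_forall hF) isOpen_ball).comp (fun z : 𝔻 => (z : ℂ))
    (fun z _ => coe_mem_ball z) Complex.UnitDisc.continuous_coe.continuousOn

theorem isCompact_setOf_norm_le {r : ℝ} (hr : r < 1) : IsCompact {z : 𝔻 | ‖(z : ℂ)‖ ≤ r} := by
  rw [Complex.UnitDisc.isEmbedding_coe.isCompact_iff]
  convert isCompact_closedBall (0 : ℂ) r using 1
  ext w
  simp only [Set.mem_image, Set.mem_ofPred_eq, mem_closedBall_zero_iff]
  refine ⟨fun ⟨_, hz, hzw⟩ => hzw ▸ hz, fun hw => ?_⟩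
  exact ⟨.mk w (hw.trans_lt hr), hw, rfl⟩

theorem tendsto_norm_cocompact : Tendsto (fun z : 𝔻 => ‖(z : ℂ)‖) (cocompact 𝔻) (𝓝[<] 1) := by
  refine tendsto_nhdsWithin_of_tendsto_nhds_of_eventually_within _
    (tendsto_order.2 ⟨fun r hr => ?_, fun r hr => .of_forall fun z => z.norm_lt_one.trans hr⟩)
    (.of_forall Complex.UnitDisc.norm_lt_one)
  filter_upwards [(isCompact_setOf_norm_le hr).compl_mem_cocompact] with z hz
  exact not_le.1 hz

end Disc

section Montel

theorem tendstoLocallyUniformlyOn_of_equicontinuousOn {X α ι : Type*} [TopologicalSpace X]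
    [LocallyCompactSpace X] [UniformSpace α] {F : ι → X → α} {f : X → α} {l : Filter ι}
    {s : Set X} (hs : IsOpen s) (hF : EquicontinuousOn F s)
    (hf : ∀ x ∈ s, Tendsto (F · x) l (𝓝 (f x))) : TendstoLocallyUniformlyOn F f l s := by
  rw [tendstoLocallyUniformlyOn_iff_forall_isCompact hs]
  intro K hKs hK
  have hK' : ∀ t ∈ ({K} : Set (Set X)), IsCompact t := by rintro _ rfl; exact hK
  have hF' : ∀ t ∈ ({K} : Set (Set X)), EquicontinuousOn F t := by rintro _ rfl; exact hF.mono hKs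
  have hlim := (EquicontinuousOn.tendsto_uniformOnFun_iff_pi' hK' hF' l f).2 <|
    tendsto_pi_nhds.2 fun x => hf x (hKs (by simpa only [Set.sUnion_singleton] using x.2))
  exact UniformOnFun.tendsto_iff_tendstoUniformlyOn.1 hlim K rfl

theorem isCompact_range_of_ultrafilter {ι X : Type*} [TopologicalSpace X] {f : ι → X}
    (h : ∀ U : Ultrafilter ι, ∃ i, Tendsto f U (𝓝 (f i))) : IsCompact (Set.range f) := by
  rw [isCompact_iff_ultrafilter_le_nhds']
  intro V hV
  rw [← Set.image_univ] at hV
  obtain ⟨i, hi⟩ := h (Ultrafilter.ofComapInfPrincipal hV)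
  refine ⟨f i, Set.mem_range_self i, ?_⟩
  rwa [← Ultrafilter.ofComapInfPrincipal_eq_of_map hV]

variable {ν : Weight} {ι : Type*} {l : Filter ι} {u : ι → Bloch ν} {R : ℝ}

theorem Bloch.norm_derivative_le (f : Bloch ν) (z : 𝔻) : ν z * ‖derivative f.1 z‖ ≤ ‖f‖ :=
  (MemBloch.le_seminorm f.2 z).trans (le_add_of_nonneg_left (norm_nonneg _))

theorem Bloch.exists_lipschitzOnWith_extend (ν : Weight) {r : ℝ} (hr : r < 1) :
    ∃ K : ℝ≥0, ∀ f : Bloch ν, LipschitzOnWith (K * ‖f‖₊) (extend f.1) (closedBall 0 r) := by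
  obtain ⟨c, hc, hcν⟩ := (isCompact_setOf_norm_le hr).exists_forall_le'
    ν.continuous.continuousOn fun z _ => ν.pos z
  refine ⟨⟨c⁻¹, inv_nonneg.2 hc.le⟩, fun f => ?_⟩
  refine (convex_closedBall (0 : ℂ) r).lipschitzOnWith_of_nnnorm_deriv_le ?_ ?_ <;>
    intro w hw <;> rw [mem_closedBall_zero_iff] at hw <;>
    lift w to 𝔻 using hw.trans_lt hr
  · exact IsHolomorphic.differentiableAt f.2.1 w
  · change ‖derivative f.1 w‖ ≤ c⁻¹ * ‖f‖
    rw [inv_mul_eq_div, le_div_iff₀' hc]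
    exact (mul_le_mul_of_nonneg_right (hcν w hw) (norm_nonneg _)).trans (f.norm_derivative_le w)

theorem Bloch.exists_norm_apply_le (ν : Weight) (z : 𝔻) :
    ∃ C, ∀ f : Bloch ν, ‖f.1 z‖ ≤ C * ‖f‖ := by
  obtain ⟨K, hK⟩ := Bloch.exists_lipschitzOnWith_extend ν z.norm_lt_one
  refine ⟨1 + K * ‖(z : ℂ)‖, fun f => ?_⟩
  have hlip : ‖f.1 z - f.1 0‖ ≤ K * ‖f‖ * ‖(z : ℂ)‖ := by
    have h := (hK f).norm_sub_le (x := z) (y := (0 : 𝔻)) (by simp) (by simp)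
    rw [extend_coe, extend_coe] at h
    simpa using h
  have h0 : ‖f.1 0‖ ≤ ‖f‖ := le_add_of_nonneg_right (seminorm_nonneg ν _)
  calc ‖f.1 z‖ ≤ ‖f.1 0‖ + ‖f.1 z - f.1 0‖ := norm_le_norm_add_norm_sub' _ _
    _ ≤ ‖f‖ + K * ‖f‖ * ‖(z : ℂ)‖ := add_le_add h0 hlip
    _ = (1 + K * ‖(z : ℂ)‖) * ‖f‖ := by ring

theorem Bloch.equicontinuousOn_extend (hu : ∀ i, ‖u i‖ ≤ R) :
    EquicontinuousOn (fun i => extend (u i).1) (ball 0 1) := by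
  intro x hx
  obtain ⟨r, hxr, hr⟩ := exists_between (mem_ball_zero_iff.1 hx)
  obtain ⟨K, hK⟩ := Bloch.exists_lipschitzOnWith_extend ν hr
  have hR : ∀ i, ‖u i‖₊ ≤ R.toNNReal := fun i => NNReal.le_toNNReal_of_coe_le (hu i)
  have heq : EquicontinuousWithinAt (fun i => extend (u i).1) (closedBall 0 r) x :=
    (LipschitzOnWith.uniformEquicontinuousOn _ (K * R.toNNReal) fun i =>
      (hK (u i)).weaken (mul_le_mul_right (hR i) K)).equicontinuousOn x
        (mem_closedBall_zero_iff.2 hxr.le)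
  have hnhds : closedBall 0 r ∈ 𝓝 x := closedBall_mem_nhds_of_mem (mem_ball_zero_iff.2 hxr)
  exact fun U hU => (heq U hU).filter_mono (nhdsWithin_le_of_mem (mem_nhdsWithin_of_mem_nhds hnhds))

theorem Bloch.exists_eq_of_tendstoLocallyUniformlyOn [l.NeBot] (hu : ∀ i, ‖u i‖ ≤ R) {G : ℂ → ℂ}
    (hG : TendstoLocallyUniformlyOn (fun i => extend (u i).1) G l (ball 0 1)) :
    ∃ g : Bloch ν, ‖g‖ ≤ R ∧ ∀ z : 𝔻, g.1 z = G z := by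
  have hhol : ∀ i, DifferentiableOn ℂ (extend (u i).1) (ball 0 1) := fun i => (u i).2.1
  have hderiv := hG.deriv (.of_forall hhol) isOpen_ball
  have hbound : ∀ z : 𝔻, ν z * ‖derivative (fun z : 𝔻 => G z) z‖ ≤ R - ‖G 0‖ := by
    intro z
    rw [derivative_eq_deriv (F := G) fun _ => rfl, le_sub_iff_add_le']
    refine le_of_tendsto ((hG.tendsto_at (coe_mem_ball 0)).norm.add
      ((hderiv.tendsto_at (coe_mem_ball z)).norm.const_mul (ν z))) (.of_forall fun i => ?_)
    rw [extend_coe]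
    exact (add_le_add_right (MemBloch.le_seminorm (u i).2 z) _).trans (hu i)
  refine ⟨⟨fun z => G z, isHolomorphic_of_differentiableOn
    (hG.differentiableOn (.of_forall hhol) isOpen_ball) fun _ => rfl, R - ‖G 0‖, ?_⟩, ?_,
    fun _ => rfl⟩
  · rintro _ ⟨z, rfl⟩
    exact hbound z
  · exact le_sub_iff_add_le'.1 (ciSup_le hbound)

theorem Bloch.exists_tendstoLocallyUniformlyOn_extend (U : Ultrafilter ι) (hu : ∀ i, ‖u i‖ ≤ R) :
    ∃ g : Bloch ν, ‖g‖ ≤ R ∧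
      TendstoLocallyUniformlyOn (fun i => extend (u i).1) (extend g.1) U (ball 0 1) := by
  have hpt : ∀ w ∈ ball (0 : ℂ) 1, ∃ c, Tendsto (fun i => extend (u i).1 w) U (𝓝 c) := by
    intro w hw
    lift w to 𝔻 using mem_ball_zero_iff.1 hw
    obtain ⟨C, hC⟩ := Bloch.exists_norm_apply_le ν w
    have hmem : ∀ i, extend (u i).1 w ∈ closedBall (0 : ℂ) (|C| * R) := by
      intro i
      rw [mem_closedBall_zero_iff, extend_coe]
      calc ‖(u i).1 w‖ ≤ C * ‖u i‖ := hC (u i)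
        _ ≤ |C| * R := by gcongr; exacts [le_abs_self C, hu i]
    obtain ⟨c, -, hc⟩ := (isCompact_closedBall (0 : ℂ) _).ultrafilter_le_nhds'
      (U.map fun i => extend (u i).1 w) (mem_map.2 (univ_mem' hmem))
    exact ⟨c, hc⟩
  choose! G hG using hpt
  have hlim := tendstoLocallyUniformlyOn_of_equicontinuousOn isOpen_ball
    (Bloch.equicontinuousOn_extend hu) hG
  obtain ⟨g, hgR, hg⟩ := Bloch.exists_eq_of_tendstoLocallyUniformlyOn hu hlim
  exact ⟨g, hgR, hlim.congr_right (extend_eqOn hg).symm⟩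

end Montel

section Compactness

variable {μ ν : Weight} {φ : 𝔻 → 𝔻} {ι : Type*} {l : Filter ι} {u : ι → Bloch ν} {R : ℝ}

/-- Evaluation at a point of the disc as a continuous linear functional on the Bloch space; it
identifies limits in the norm topology with pointwise limits. -/
noncomputable def Bloch.evalCLM (ν : Weight) (z : 𝔻) : Bloch ν →L[ℂ] ℂ :=
  LinearMap.mkContinuousOfExistsBound
    { toFun := fun f => f.1 z
      map_add' := fun _ _ => rfl
      map_smul' := fun _ _ => rfl } (Bloch.exists_norm_apply_le ν z)

theorem Bloch.tendsto_zero_of_mem_isCompact {K : Set (Bloch ν)} (hK : IsCompact K)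
    (hu : ∀ i, u i ∈ K) (h0 : ∀ z, Tendsto (fun i => (u i).1 z) l (𝓝 0)) : Tendsto u l (𝓝 0) := by
  refine hK.tendsto_nhds_of_unique_mapClusterPt (.of_forall hu) fun g _ hg => ?_
  refine Subtype.ext (funext fun z => ?_)
  have hgz : MapClusterPt (g.1 z) l fun i => (u i).1 z :=
    hg.tendsto_comp ((Bloch.evalCLM ν z).continuous.tendsto g)
  exact eq_of_nhds_neBot (hgz.neBot.mono (inf_le_inf_left _ (h0 z)))

theorem IsCompactCompOp.tendsto_seminorm_comp (hc : IsCompactCompOp ν μ φ) (hu : ∀ i, ‖u i‖ ≤ R)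
    (h0 : ∀ z, Tendsto (fun i => (u i).1 z) l (𝓝 0)) :
    Tendsto (fun i => seminorm μ ((u i).1 ∘ φ)) l (𝓝 0) := by
  obtain ⟨h, hcomp⟩ := hc
  obtain ⟨K, hK, hRK⟩ := hcomp.image_closedBall_subset_compact R
  have hlim : Tendsto (fun i => compOp ν μ φ h (u i)) l (𝓝 0) :=
    Bloch.tendsto_zero_of_mem_isCompact hK
      (fun i => hRK ⟨u i, mem_closedBall_zero_iff.2 (hu i), rfl⟩) fun z => h0 (φ z)
  exact squeeze_zero (fun i => seminorm_nonneg μ _)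
    (fun i => le_add_of_nonneg_left (norm_nonneg _)) (tendsto_zero_iff_norm_tendsto_zero.1 hlim)

/-- The pointwise criterion for compactness of `C_φ : 𝓑^ν → 𝓑^μ`:
`μ(z) |φ'(z)| = o(ν(φ(z)))` as `|φ(z)| → 1`. The limit is encoded by the filter of the sets on
whose complement `φ` takes values in a compact subset of the disc. -/
def IsLittleOAtBoundary (ν μ : Weight) (φ : 𝔻 → 𝔻) : Prop :=
  (fun z => μ z * ‖derivative (fun z => (φ z : ℂ)) z‖) =o[comap φ (cocompact 𝔻)] fun z => ν (φ z)

theorem IsLittleOAtBoundary.exists_isCompact (ho : IsLittleOAtBoundary ν μ φ) {ε : ℝ}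
    (hε : 0 < ε) : ∃ K : Set 𝔻, IsCompact K ∧
      ∀ z, φ z ∉ K → μ z * ‖derivative (fun z => (φ z : ℂ)) z‖ ≤ ε * ν (φ z) := by
  obtain ⟨K, hK, hle⟩ := ((hasBasis_cocompact.comap φ).eventually_iff).1 (isLittleO_iff.1 ho hε)
  refine ⟨K, hK, fun z hz => ?_⟩
  have h := hle hz
  rwa [Real.norm_of_nonneg (mul_nonneg (μ.pos z).le (norm_nonneg _)),
    Real.norm_of_nonneg (ν.pos _).le] at h

theorem mul_norm_derivative_comp {f : 𝔻 → ℂ} (hf : IsHolomorphic f)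
    (hφ : IsHolomorphic fun z => (φ z : ℂ)) (z : 𝔻) : μ z * ‖derivative (f ∘ φ) z‖ =
      μ z * ‖derivative (fun z => (φ z : ℂ)) z‖ * ‖derivative f (φ z)‖ := by
  rw [derivative_comp hf hφ, norm_mul]
  ring

theorem IsLittleOAtBoundary.exists_le_mul (ho : IsLittleOAtBoundary ν μ φ)
    (hφ : MemBloch μ fun z => (φ z : ℂ)) :
    ∃ C, 0 ≤ C ∧ ∀ z, μ z * ‖derivative (fun z => (φ z : ℂ)) z‖ ≤ C * ν (φ z) := by
  obtain ⟨K, hK, hle⟩ := ho.exists_isCompact one_pos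
  obtain ⟨c, hc, hcν⟩ := hK.exists_forall_le' ν.continuous.continuousOn fun z _ => ν.pos z
  refine ⟨max 1 (seminorm μ (fun z => (φ z : ℂ)) / c), le_max_of_le_left zero_le_one, fun z => ?_⟩
  by_cases hz : φ z ∈ K
  · calc μ z * ‖derivative (fun z => (φ z : ℂ)) z‖
        ≤ seminorm μ fun z => (φ z : ℂ) := hφ.le_seminorm z
      _ = seminorm μ (fun z => (φ z : ℂ)) / c * c := (div_mul_cancel₀ _ hc.ne').symm
      _ ≤ _ := by gcongr; exacts [le_max_right _ _, hcν _ hz]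
  · exact (hle z hz).trans (mul_le_mul_of_nonneg_right (le_max_left _ _) (ν.pos _).le)

theorem IsLittleOAtBoundary.memBloch_comp (ho : IsLittleOAtBoundary ν μ φ)
    (hφ : MemBloch μ fun z => (φ z : ℂ)) {f : 𝔻 → ℂ} (hf : MemBloch ν f) :
    MemBloch μ (f ∘ φ) := by
  obtain ⟨C, hC0, hC⟩ := ho.exists_le_mul hφ
  refine ⟨hf.1.comp hφ.1, C * seminorm ν f, ?_⟩
  rintro _ ⟨z, rfl⟩
  calc μ z * ‖derivative (f ∘ φ) z‖
      = μ z * ‖derivative (fun z => (φ z : ℂ)) z‖ * ‖derivative f (φ z)‖ :=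
        mul_norm_derivative_comp hf.1 hφ.1 z
    _ ≤ C * ν (φ z) * ‖derivative f (φ z)‖ := mul_le_mul_of_nonneg_right (hC z) (norm_nonneg _)
    _ = C * (ν (φ z) * ‖derivative f (φ z)‖) := mul_assoc _ _ _
    _ ≤ C * seminorm ν f := by gcongr; exact hf.le_seminorm _

theorem IsLittleOAtBoundary.tendsto_seminorm_comp (ho : IsLittleOAtBoundary ν μ φ)
    (hφ : MemBloch μ fun z => (φ z : ℂ)) (hu : ∀ i, ‖u i‖ ≤ R)
    (hlim : TendstoLocallyUniformly (fun i => derivative (u i).1) 0 l) :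
    Tendsto (fun i => seminorm μ ((u i).1 ∘ φ)) l (𝓝 0) := by
  suffices h : ∀ ε > 0, ∀ᶠ i in l, seminorm μ ((u i).1 ∘ φ) ≤ ε by
    refine tendsto_order.2 ⟨fun a ha => .of_forall fun i => ha.trans_le (seminorm_nonneg μ _),
      fun a ha => (h (a / 2) (half_pos ha)).mono fun i hi => hi.trans_lt (half_lt_self ha)⟩
  intro ε hε
  set M := seminorm μ fun z => (φ z : ℂ)
  have hM : 0 ≤ M := seminorm_nonneg μ _
  obtain ⟨K, hK, hle⟩ := ho.exists_isCompact (show 0 < ε / (|R| + 1) by positivity)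
  have hunif := (tendstoLocallyUniformlyOn_iff_tendstoUniformlyOn_of_compact hK).1
    hlim.tendstoLocallyUniformlyOn
  filter_upwards [Metric.tendstoUniformlyOn_iff.1 hunif (ε / (M + 1)) (by positivity)] with i hi
  refine ciSup_le fun z => ?_
  rw [mul_norm_derivative_comp (u i).2.1 hφ.1]
  by_cases hz : φ z ∈ K
  · have hsmall : ‖derivative (u i).1 (φ z)‖ ≤ ε / (M + 1) := by
      simpa using (hi (φ z) hz).le
    calc μ z * ‖derivative (fun z => (φ z : ℂ)) z‖ * ‖derivative (u i).1 (φ z)‖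
        ≤ (M + 1) * (ε / (M + 1)) := by
          gcongr
          linarith [hφ.le_seminorm z]
      _ = ε := by field_simp
  · calc μ z * ‖derivative (fun z => (φ z : ℂ)) z‖ * ‖derivative (u i).1 (φ z)‖
        ≤ ε / (|R| + 1) * ν (φ z) * ‖derivative (u i).1 (φ z)‖ :=
          mul_le_mul_of_nonneg_right (hle z hz) (norm_nonneg _)
      _ = ε / (|R| + 1) * (ν (φ z) * ‖derivative (u i).1 (φ z)‖) := mul_assoc _ _ _
      _ ≤ ε / (|R| + 1) * (|R| + 1) := by
          gcongr
          linarith [(u i).norm_derivative_le (φ z), hu i, le_abs_self R]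
      _ = ε := by field_simp

theorem IsLittleOAtBoundary.tendsto_compOp (ho : IsLittleOAtBoundary ν μ φ)
    (hφ : MemBloch μ fun z => (φ z : ℂ)) (h : ∀ f, MemBloch ν f → MemBloch μ (f ∘ φ))
    (hu : ∀ i, ‖u i‖ ≤ R) {g : Bloch ν}
    (hg : TendstoLocallyUniformlyOn (fun i => extend (u i).1) (extend g.1) l (ball 0 1)) :
    Tendsto (fun i => compOp ν μ φ h (u i)) l (𝓝 (compOp ν μ φ h g)) := by
  have hderiv : TendstoLocallyUniformly (fun i => derivative (u i - g).1) 0 l := by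
    have hlim := tendstoLocallyUniformly_derivative (fun i => (u i).2.1) hg
    rw [Metric.tendstoLocallyUniformly_iff] at hlim ⊢
    intro ε hε z
    obtain ⟨t, ht, hclose⟩ := hlim ε hε z
    refine ⟨t, ht, hclose.mono fun i hi w hw => ?_⟩
    have hsub : derivative (u i - g).1 w = derivative (u i).1 w - derivative g.1 w :=
      derivative_sub (u i).2.1 g.2.1 w
    simpa [hsub, dist_eq_norm_sub'] using hi w hw
  have hseminorm := ho.tendsto_seminorm_comp hφ
    (fun i => (norm_sub_le (u i) g).trans (add_le_add_left (hu i) ‖g‖)) hderiv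
  have hzero : Tendsto (fun i => ‖(u i).1 (φ 0) - g.1 (φ 0)‖) l (𝓝 0) := by
    simpa only [extend_coe] using
      tendsto_iff_norm_sub_tendsto_zero.1 (hg.tendsto_at (coe_mem_ball (φ 0)))
  have hsum := hzero.add hseminorm
  rw [add_zero] at hsum
  exact tendsto_iff_norm_sub_tendsto_zero.2 hsum

theorem IsLittleOAtBoundary.isCompactCompOp (ho : IsLittleOAtBoundary ν μ φ)
    (hφ : MemBloch μ fun z => (φ z : ℂ)) : IsCompactCompOp ν μ φ := by
  have h := fun f => ho.memBloch_comp hφ (f := f)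
  refine ⟨h, (isCompactOperator_iff_image_closedBall_subset_compact _ one_pos).2
    ⟨_, ?_, subset_rfl⟩⟩
  rw [Set.image_eq_range]
  refine isCompact_range_of_ultrafilter fun U => ?_
  have hball : ∀ f : closedBall (0 : Bloch ν) 1, ‖f.1‖ ≤ 1 := fun f => mem_closedBall_zero_iff.1 f.2
  obtain ⟨g, hg1, hg⟩ := Bloch.exists_tendstoLocallyUniformlyOn_extend U hball
  exact ⟨⟨g, mem_closedBall_zero_iff.2 hg1⟩, ho.tendsto_compOp hφ h hball hg⟩

end Compactness

section Monomials

theorem isHolomorphic_monomial (j : ℕ) : IsHolomorphic (monomial j) :=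
  isHolomorphic_of_differentiableOn (differentiable_pow j).differentiableOn fun _ => rfl

theorem norm_derivative_monomial (j : ℕ) (z : 𝔻) :
    ‖derivative (monomial j) z‖ = j * ‖(z : ℂ)‖ ^ (j - 1) := by
  rw [derivative_eq_deriv (F := fun w => w ^ j) (fun _ => rfl : ∀ z, monomial j z = _)]
  simp

theorem vlog_apply (z : 𝔻) : vlog z = (1 - ‖(z : ℂ)‖) * Real.log (3 / (1 - ‖(z : ℂ)‖)) := rfl

theorem add_one_mul_mul_one_sub_pow_le_one (n : ℕ) {t : ℝ} (h0 : 0 ≤ t) (h1 : t ≤ 1) :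
    (n + 1) * t * (1 - t) ^ n ≤ 1 := by
  have : 0 ≤ 1 - t := sub_nonneg.2 h1
  calc (n + 1) * t * (1 - t) ^ n ≤ (1 + n * t) * (1 - t) ^ n := by
        gcongr
        linarith
    _ ≤ (1 + t) ^ n * (1 - t) ^ n := by
        gcongr
        exact one_add_mul_le_pow (by linarith) n
    _ = (1 - t ^ 2) ^ n := by rw [← mul_pow]; ring
    _ ≤ 1 := pow_le_one₀ (by nlinarith) (by nlinarith)

theorem mul_log_three_div_mul_one_sub_pow_le (n : ℕ) {t : ℝ} (h0 : 0 < t) (h1 : t ≤ 1) :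
    t * Real.log (3 / t) * ((n + 1) * (1 - t) ^ n) ≤ 4 * Real.log (n + 2) := by
  have h1t : 0 ≤ 1 - t := sub_nonneg.2 h1
  have hpow1 : (1 - t) ^ n ≤ 1 := pow_le_one₀ h1t (by linarith)
  have hlog : Real.log (3 / t) ≤ Real.log (3 * (n + 1)) + 1 / ((n + 1) * t) := by
    calc Real.log (3 / t) = Real.log (3 * (n + 1) * (1 / ((n + 1) * t))) := by
          congr 1
          field_simp
      _ = Real.log (3 * (n + 1)) + Real.log (1 / ((n + 1) * t)) :=
          Real.log_mul (by positivity) (by positivity)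
      _ ≤ _ := by
          gcongr
          exact Real.log_le_self (by positivity)
  have hlog0 : 0 ≤ Real.log (3 * (n + 1)) := Real.log_nonneg (by linarith [n.cast_nonneg (α := ℝ)])
  have hlog3 : Real.log (3 * (n + 1)) ≤ 2 * Real.log (n + 2) := by
    calc Real.log (3 * (n + 1)) ≤ Real.log ((n + 2 : ℝ) ^ 2) :=
          Real.log_le_log (by positivity) (by nlinarith [n.cast_nonneg (α := ℝ)])
      _ = 2 * Real.log (n + 2) := by simp
  have hlog2 : 1 ≤ 2 * Real.log (n + 2) := by
    have hmono : Real.log 2 ≤ Real.log (n + 2) := Real.log_le_log two_pos (by simp)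
    linarith [Real.log_two_gt_d9]
  calc t * Real.log (3 / t) * ((n + 1) * (1 - t) ^ n)
      = (n + 1) * t * (1 - t) ^ n * Real.log (3 / t) := by ring
    _ ≤ (n + 1) * t * (1 - t) ^ n * (Real.log (3 * (n + 1)) + 1 / ((n + 1) * t)) := by gcongr
    _ = (n + 1) * t * (1 - t) ^ n * Real.log (3 * (n + 1)) + (1 - t) ^ n := by field_simp
    _ ≤ 1 * Real.log (3 * (n + 1)) + 1 := by
        gcongr
        exact add_one_mul_mul_one_sub_pow_le_one n h0.le h1
    _ ≤ 4 * Real.log (n + 2) := by linarith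

theorem vlog_mul_norm_derivative_monomial_le (j : ℕ) (z : 𝔻) :
    vlog z * ‖derivative (monomial j) z‖ ≤ 4 * Real.log (j + 1) := by
  rw [norm_derivative_monomial, vlog_apply]
  obtain _ | n := j
  · simp
  · have h := mul_log_three_div_mul_one_sub_pow_le n (sub_pos.2 z.norm_lt_one)
      (sub_le_self 1 (norm_nonneg _))
    rw [sub_sub_cancel] at h
    simpa [add_assoc, one_add_one_eq_two] using h

theorem memBloch_vlog_monomial (j : ℕ) : MemBloch vlog (monomial j) := by
  refine ⟨isHolomorphic_monomial j, 4 * Real.log (j + 1), ?_⟩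
  rintro _ ⟨z, rfl⟩
  exact vlog_mul_norm_derivative_monomial_le j z

/-- An index `j` for which `v_log |F_j'|` at `w` is comparable to its supremum over the disc. Since
`t (1 - t)^(j - 1)` peaks at `t = 1 / j`, it has to be of the order of `1 / (1 - |w|)`; the factor
`2` lets Bernoulli's inequality bound `|w|^(j - 1)` below by `1 / 2`. -/
noncomputable def peakIndex (w : 𝔻) : ℕ := ⌈1 / (2 * (1 - ‖(w : ℂ)‖))⌉₊

theorem one_le_peakIndex (w : 𝔻) : 1 ≤ peakIndex w :=
  Nat.ceil_pos.2 (by have := sub_pos.2 w.norm_lt_one; positivity)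

theorem tendsto_peakIndex : Tendsto peakIndex (cocompact 𝔻) atTop := by
  have hzero : Tendsto (fun r : ℝ => 2 * (1 - r)) (𝓝[<] 1) (𝓝[>] 0) := by
    refine tendsto_nhdsWithin_of_tendsto_nhds_of_eventually_within _ ?_
      (eventually_mem_nhdsWithin.mono fun r hr => Set.mem_Ioi.2 (mul_pos two_pos (sub_pos.2 hr)))
    exact (Continuous.tendsto' (by fun_prop) 1 0 (by simp)).mono_left nhdsWithin_le_nhds
  exact (tendsto_nat_ceil_atTop.comp (tendsto_inv_nhdsGT_zero.comp
    (hzero.comp tendsto_norm_cocompact))).congr fun w => by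
      simp only [Function.comp_apply, peakIndex, one_div]

theorem exists_peakIndex_eq {j : ℕ} (hj : 1 ≤ j) : ∃ w, peakIndex w = j := by
  have hj' : (1 : ℝ) ≤ j := Nat.one_le_cast.2 hj
  have hhalf : 1 / (2 * (j : ℝ)) ≤ 1 / 2 := by
    gcongr
    linarith
  have hnorm : ‖((1 - 1 / (2 * j) : ℝ) : ℂ)‖ = 1 - 1 / (2 * j) :=
    Complex.norm_of_nonneg (by linarith)
  refine ⟨.mk ((1 - 1 / (2 * j) : ℝ) : ℂ) (by rw [hnorm]; exact sub_lt_self 1 (by positivity)), ?_⟩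
  rw [peakIndex, Complex.UnitDisc.coe_mk, hnorm, sub_sub_cancel,
    show 1 / (2 * (1 / (2 * (j : ℝ)))) = j by field_simp, Nat.ceil_natCast]

theorem log_peakIndex_le (w : 𝔻) : Real.log (peakIndex w + 1) ≤
    4 * (vlog w * ‖derivative (monomial (peakIndex w)) w‖) := by
  rw [norm_derivative_monomial, vlog_apply]
  have hone := one_le_peakIndex w
  set j := peakIndex w
  set t := 1 - ‖(w : ℂ)‖
  have ht0 : 0 < t := sub_pos.2 w.norm_lt_one
  have ht1 : t ≤ 1 := sub_le_self 1 (norm_nonneg _)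
  have hlower : 1 / 2 ≤ t * j := by
    have hceil : 1 / (2 * t) ≤ j := Nat.le_ceil _
    rw [div_le_iff₀ (by positivity)] at hceil
    linarith
  have hupper : t * j ≤ 1 / 2 + t := by
    have hceil : j < 1 / (2 * t) + 1 := Nat.ceil_lt_add_one (by positivity)
    calc t * j ≤ t * (1 / (2 * t) + 1) := by gcongr
      _ = 1 / 2 + t := by field_simp
  have hpow : 1 / 2 ≤ ‖(w : ℂ)‖ ^ (j - 1) := by
    have hbernoulli := one_add_mul_le_pow (show -2 ≤ -t by linarith) (j - 1)
    rw [Nat.cast_sub hone, Nat.cast_one, ← sub_eq_add_neg, sub_sub_cancel] at hbernoulli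
    linarith
  have hlog : Real.log (j + 1) ≤ Real.log (3 / t) := by
    refine Real.log_le_log (by positivity) ((le_div_iff₀ ht0).2 ?_)
    linarith
  have hlog0 : 0 ≤ Real.log (3 / t) := (Real.log_nonneg (by simp)).trans hlog
  calc Real.log (j + 1) = 4 * (Real.log (j + 1) * (1 / 2 * (1 / 2))) := by ring
    _ ≤ 4 * (Real.log (3 / t) * (t * j * ‖(w : ℂ)‖ ^ (j - 1))) := by gcongr
    _ = 4 * (t * Real.log (3 / t) * (j * ‖(w : ℂ)‖ ^ (j - 1))) := by ring

theorem log_le_seminorm_vlog_monomial (j : ℕ) :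
    Real.log (j + 1) ≤ 4 * seminorm vlog (monomial j) := by
  obtain rfl | hj := j.eq_zero_or_pos
  · simpa using seminorm_nonneg vlog (monomial 0)
  · obtain ⟨w, rfl⟩ := exists_peakIndex_eq hj
    exact (log_peakIndex_le w).trans
      (mul_le_mul_of_nonneg_left ((memBloch_vlog_monomial _).le_seminorm w) zero_le_four)

theorem isTheta_seminorm_vlog_monomial :
    (fun j : ℕ => seminorm vlog (monomial j)) =Θ[atTop] fun j : ℕ => Real.log (j + 1) := by
  have hlog : ∀ j : ℕ, ‖Real.log (j + 1)‖ = Real.log (j + 1) := fun j =>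
    Real.norm_of_nonneg (Real.log_nonneg (by simp))
  have hnorm : ∀ j, ‖seminorm vlog (monomial j)‖ = seminorm vlog (monomial j) := fun j =>
    Real.norm_of_nonneg (seminorm_nonneg _ _)
  refine ⟨.of_bound 4 (.of_forall fun j => ?_), .of_bound 4 (.of_forall fun j => ?_)⟩
  · rw [hlog, hnorm]
    exact ciSup_le (vlog_mul_norm_derivative_monomial_le j)
  · rw [hlog, hnorm]
    exact log_le_seminorm_vlog_monomial j

end Monomials

section Powers

variable {μ : Weight} {φ : 𝔻 → 𝔻}

theorem IsCompactCompOp.memBloch_power (hc : IsCompactCompOp vlog μ φ) (j : ℕ) :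
    MemBloch μ (power φ j) :=
  hc.1 _ (memBloch_vlog_monomial j)

/-- The monomial `F_j` as an element of the log-Bloch space. -/
noncomputable def blochMonomial (j : ℕ) : Bloch vlog := ⟨monomial j, memBloch_vlog_monomial j⟩

/-- The monomial `F_j` divided by `‖F_j‖_log`, which makes a bounded sequence to test compactness
on. It is `0` for `j = 0`, where `‖F_0‖_log = 0`. -/
noncomputable def normalizedMonomial (j : ℕ) : Bloch vlog :=
  (seminorm vlog (monomial j) : ℂ)⁻¹ • blochMonomial j

theorem seminorm_vlog_monomial_zero : seminorm vlog (monomial 0) = 0 := by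
  simp [seminorm, norm_derivative_monomial]

theorem norm_normalizedMonomial_le (j : ℕ) : ‖normalizedMonomial j‖ ≤ 1 := by
  rw [normalizedMonomial, norm_smul, norm_inv, Complex.norm_of_nonneg (seminorm_nonneg _ _)]
  change (seminorm vlog (monomial j))⁻¹ * (‖monomial j 0‖ + seminorm vlog (monomial j)) ≤ 1
  obtain rfl | hj := eq_or_ne j 0
  · simp [seminorm_vlog_monomial_zero]
  · simpa [monomial, hj] using inv_mul_le_one

theorem tendsto_normalizedMonomial_apply (z : 𝔻) :
    Tendsto (fun j => (normalizedMonomial j).1 z) atTop (𝓝 0) := by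
  have hatTop : Tendsto (fun j : ℕ => seminorm vlog (monomial j)) atTop atTop := by
    have hlog : Tendsto (fun j : ℕ => Real.log (j + 1) / 4) atTop atTop :=
      (Real.tendsto_log_atTop.comp
        (tendsto_natCast_atTop_atTop.atTop_add tendsto_const_nhds)).atTop_div_const four_pos
    exact tendsto_atTop_mono
      (fun j => (div_le_iff₀' four_pos).2 (log_le_seminorm_vlog_monomial j)) hlog
  refine squeeze_zero_norm (fun j => ?_) (tendsto_inv_atTop_zero.comp hatTop)
  change ‖(seminorm vlog (monomial j) : ℂ)⁻¹ * (z : ℂ) ^ j‖ ≤ (seminorm vlog (monomial j))⁻¹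
  rw [norm_mul, norm_inv, norm_pow, Complex.norm_of_nonneg (seminorm_nonneg _ _)]
  exact mul_le_of_le_one_right (inv_nonneg.2 (seminorm_nonneg _ _))
    (pow_le_one₀ (norm_nonneg _) z.norm_lt_one.le)

theorem IsCompactCompOp.tendsto_seminorm_power_div (hc : IsCompactCompOp vlog μ φ) :
    Tendsto (fun j => seminorm μ (power φ j) / seminorm vlog (monomial j)) atTop (𝓝 0) := by
  refine (hc.tendsto_seminorm_comp norm_normalizedMonomial_le
    tendsto_normalizedMonomial_apply).congr fun j => ?_
  change seminorm μ ((seminorm vlog (monomial j) : ℂ)⁻¹ • power φ j) = _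
  rw [seminorm_smul _ (hc.memBloch_power j), norm_inv,
    Complex.norm_of_nonneg (seminorm_nonneg _ _), inv_mul_eq_div]

theorem isLittleOAtBoundary_of_tendsto (hφ : IsHolomorphic fun z => (φ z : ℂ))
    (hmem : ∀ᶠ j in atTop, MemBloch μ (power φ j))
    (hlim : Tendsto (fun j : ℕ => seminorm μ (power φ j) / Real.log (j + 1)) atTop (𝓝 0)) :
    IsLittleOAtBoundary vlog μ φ := by
  refine isLittleO_iff.2 fun ε hε => ?_
  have hsmall := hmem.and (hlim.eventually_lt_const (show 0 < ε / 4 by positivity))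
  filter_upwards [(tendsto_peakIndex.comp tendsto_comap).eventually hsmall] with z ⟨hj, hlt⟩
  rw [Real.norm_of_nonneg (mul_nonneg (μ.pos z).le (norm_nonneg _)),
    Real.norm_of_nonneg (vlog.pos _).le]
  have hlog := log_peakIndex_le (φ z)
  have hlog0 : 0 < Real.log (peakIndex (φ z) + 1) :=
    Real.log_pos (lt_add_of_pos_left 1 (Nat.cast_pos.2 (one_le_peakIndex (φ z))))
  simp only [Function.comp_apply] at hj hlt
  set j := peakIndex (φ z)
  have hderiv : 0 < ‖derivative (monomial j) (φ z)‖ := by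
    refine pos_of_mul_pos_right (a := vlog (φ z)) ?_ (vlog.pos _).le
    linarith
  refine le_of_mul_le_mul_right ?_ hderiv
  calc μ z * ‖derivative (fun z => (φ z : ℂ)) z‖ * ‖derivative (monomial j) (φ z)‖
      = μ z * ‖derivative (power φ j) z‖ :=
        (mul_norm_derivative_comp (isHolomorphic_monomial j) hφ z).symm
    _ ≤ seminorm μ (power φ j) := hj.le_seminorm z
    _ ≤ ε / 4 * Real.log (j + 1) := ((div_lt_iff₀ hlog0).1 hlt).le
    _ ≤ ε / 4 * (4 * (vlog (φ z) * ‖derivative (monomial j) (φ z)‖)) := by gcongr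
    _ = ε * vlog (φ z) * ‖derivative (monomial j) (φ z)‖ := by ring

theorem power_one (φ : 𝔻 → 𝔻) : power φ 1 = (fun z => (φ z : ℂ)) :=
  funext fun _ => pow_one _

end Powers

end LogBloch

theorem theorem5p5 (μ : LogBloch.Weight) (φ : 𝔻 → 𝔻)
    (hφ : LogBloch.IsHolomorphic fun z => (φ z : ℂ)) :
    (LogBloch.IsCompactCompOp LogBloch.vlog μ φ ↔
      (∀ j : ℕ, 1 ≤ j → LogBloch.MemBloch μ (LogBloch.power φ j)) ∧
        Tendsto (fun j : ℕ => LogBloch.seminorm μ (LogBloch.power φ j) / Real.log ((j : ℝ) + 1))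
          atTop (𝓝 0)) ∧
    (LogBloch.IsCompactCompOp LogBloch.vlog μ φ ↔
      (∀ j : ℕ, 1 ≤ j → LogBloch.MemBloch μ (LogBloch.power φ j)) ∧
        Tendsto (fun j : ℕ => LogBloch.seminorm μ (LogBloch.power φ j) /
            LogBloch.seminorm LogBloch.vlog (LogBloch.monomial j))
          atTop (𝓝 0)) := by
  have hdiv : Tendsto (fun j : ℕ => LogBloch.seminorm μ (LogBloch.power φ j) /
        LogBloch.seminorm LogBloch.vlog (LogBloch.monomial j)) atTop (𝓝 0) ↔
      Tendsto (fun j : ℕ => LogBloch.seminorm μ (LogBloch.power φ j) / Real.log ((j : ℝ) + 1))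
        atTop (𝓝 0) :=
    ((Asymptotics.isTheta_refl _ _).div LogBloch.isTheta_seminorm_vlog_monomial).tendsto_zero_iff
  rw [hdiv, and_self]
  refine ⟨fun hc => ⟨fun j _ => hc.memBloch_power j, hdiv.1 hc.tendsto_seminorm_power_div⟩,
    fun ⟨hmem, hlim⟩ => ?_⟩
  have ho := LogBloch.isLittleOAtBoundary_of_tendsto hφ (eventually_atTop.2 ⟨1, hmem⟩) hlim
  exact ho.isCompactCompOp (LogBloch.power_one φ ▸ hmem 1 le_rfl)
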